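/- Let $V=\bigoplus_{i\ge 0}\mathbb Q\,b_i$, let $\beta_j$ ($j\geq 0$) be the linear forms on $V$ with $\beta_j(b_i)=\delta_{ij}$, and for formal variables $w_1,\dots,w_k$ ($k\ge 0$) put $\beta(w_i^{-1})=\sum_{j\ge0}\beta_jw_i^{-j}$. Operators on $\bigwedge V$ are extended linearly to coefficients in $\mathbb Q[w_1^{\pm1},\dots,w_k^{\pm1}]$. For a partition $\lambda=(\lambda_1\ge\dots\ge\lambda_r\ge0)$ with at most $r$ parts let $$[\mathbf b]^r_\lambda=b_{r-1+\lambda_1}\wedge b_{r-2+\lambda_2}\wedge\dots\wedge b_{\lambda_r}\in\textstyle\bigwedge^rV .$$ Contraction: for a linear form $\beta$, $\beta\lrcorner(v_1\wedge\dots\wedge v_r)=\sum_{j}(-1)^{j+1}\beta(v_j)\,v_1\wedge\dots\widehat{v_j}\dots\wedge v_r$, and for exterior products of forms $(\alpha\wedge\omega)\lrcorner u=\alpha\lrcorner(\omega\lrcorner u)$. Let $\overline\sigma_+(z)=\sum_{i\ge0}(-1)^i\overline\sigma_iz^i:\bigwedge V\to(\bigwedge V)[z]$ be the homomorphism of algebras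 with $\overline\sigma_+(z)b_j=b_j-b_{j+1}z$, and $\overline\sigma_+(\mathbf w_k)=\overline\sigma_+(w_1)\cdots\overline\sigma_+(w_k)$. Let $B_s=\mathbb Q[e_1,\dots,e_s]$ act on $\bigwedge V$ by $e_iu=\overline\sigma_iu$, and let $H_s=(h_j)_{j\in\mathbb Z}$ be given by $\sum_jh_jz^j=1/(1-e_1z+\dots+(-1)^se_sz^s)$, with $h_j=0$ for $j<0$. Put $\sigma_-(z)h_j=\sum_{i\ge0}h_{j-i}z^{-i}$, extend $\sigma_-(z)$ linearly to linear combinations of the members of $H_s$, and let $\sigma_-(\mathbf w_k)H_s$ be the sequence $(\sigma_-(w_1)\cdots\sigma_-(w_k)h_j)_{j\in\mathbb Z}$. For a sequence $g=(g_j)_{j\in\mathbb Z}$ let $\Delta_\lambda(g)=\det(g_{\lambda_j-j+i})_{1\le i,j\le r}$. The vertex operator $\Gamma^*(\mathbf w_k)$ is the linear map on $\bigwedge V$ with $$\Gamma^*(\mathbf w_k)[\mathbf b]^r_\lambda=\overline\sigma_+(\mathbf w_k)\Big(\Delta_\lambda\big(\sigma_-(\mathbf w_k)H_{r-k}\big)\,[\mathbf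 b]^{r-k}_0\Big)\in\textstyle\bigwedge^{r-k}V\otimes\mathbb Q[w_1^{\pm1},\dots,w_k^{\pm1}],$$ which is $0$ when $k>r$. **Theorem.** For all $k,r\ge0$ and every partition $\lambda$ with at most $r$ parts, $$\big(\beta(w_k^{-1})\wedge\beta(w_{k-1}^{-1})\wedge\dots\wedge\beta(w_1^{-1})\big)\lrcorner[\mathbf b]^r_\lambda=\frac{\Delta_0(\mathbf w_k)}{(w_1\cdots w_k)^{r-1}}\;\Gamma^*(\mathbf w_k)[\mathbf b]^r_\lambda,$$ where $\Delta_0(\mathbf w_k)=\prod_{1\le i<j\le k}(w_j-w_i)$. -/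

import Mathlib

/-! Schubert derivations on the exterior algebra of a free module with a countable basis, the
module structure over a polynomial ring that they induce on it, and the vertex operator `Γ*`.

Everything is set up over a commutative ring `A` and units of `A`.  For the formal variables
`w₁, …, w_k` one takes `A = ℚ[w₁^±¹, …, w_k^±¹]`; then `LambdaV A` is
`ℚ[w₁^±¹, …, w_k^±¹] ⊗ ⋀ V` with `V = ⨁_{i ≥ 0} ℚ b_i`, and an `A`-linear operator on it is the
linear extension to coefficients in `A` of an operator on `⋀ V`. -/

noncomputable section

namespace SchubertVertex

/-- The free `A`-module with basis `b_0, b_1, b_2, …`. -/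
abbrev V (A : Type*) [CommRing A] : Type _ := ℕ →₀ A

/-- Its exterior algebra. -/
abbrev LambdaV (A : Type*) [CommRing A] : Type _ := ExteriorAlgebra A (V A)

/-- The basis vector `b_j`. -/
def b (A : Type*) [CommRing A] (j : ℕ) : V A := Finsupp.single j 1

/-- `[b]^r_λ = b_{r-1+λ_1} ∧ b_{r-2+λ_2} ∧ … ∧ b_{λ_r}`. The parts are numbered from `0` here, and
`(i.rev : ℕ) = r - 1 - i`. -/
def bWedge (A : Type*) [CommRing A] (r : ℕ) (lam : Fin r → ℕ) : LambdaV A :=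
  ExteriorAlgebra.ιMulti A r fun i => b A ((i.rev : ℕ) + lam i)

/-! ### The Schubert derivations -/

/-- `σ_1 : V → V`, `b_j ↦ b_{j+1}`. -/
def shiftUp (A : Type*) [CommRing A] : V A →ₗ[A] V A :=
  Finsupp.linearCombination A fun j => b A (j + 1)

/-- The restriction to `V` of the Schubert derivation `σ̄₊(z)`: `v ↦ v - σ_1(v) z`. -/
def sigmaBarPlusGen (A : Type*) [CommRing A] : V A →ₗ[A] Polynomial (LambdaV A) where
  toFun v := Polynomial.C (ExteriorAlgebra.ι A v)
    - Polynomial.C (ExteriorAlgebra.ι A (shiftUp A v)) * Polynomial.X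
  map_add' u v := by simp only [map_add, add_mul]; abel
  map_smul' c v := by
    simp only [map_smul, RingHom.id_apply, smul_sub, ← Polynomial.smul_C, smul_mul_assoc]

theorem sigmaBarPlusGen_sq (A : Type*) [CommRing A] (v : V A) :
    sigmaBarPlusGen A v * sigmaBarPlusGen A v = 0 := by
  have h1 := ExteriorAlgebra.ι_sq_zero (R := A) v
  have h2 := ExteriorAlgebra.ι_sq_zero (R := A) (shiftUp A v)
  have h3 := ExteriorAlgebra.ι_add_mul_swap (R := A) v (shiftUp A v)
  simp only [sigmaBarPlusGen, LinearMap.coe_mk, AddHom.coe_mk]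
  set a := ExteriorAlgebra.ι A v
  set c := ExteriorAlgebra.ι A (shiftUp A v)
  have e : (Polynomial.C a - Polynomial.C c * Polynomial.X)
        * (Polynomial.C a - Polynomial.C c * Polynomial.X)
      = Polynomial.C (a * a) - Polynomial.C (a * c + c * a) * Polynomial.X
        + Polynomial.C (c * c) * Polynomial.X * Polynomial.X := by
    simp only [Polynomial.C_mul, Polynomial.C_add, sub_mul, mul_sub, add_mul, mul_assoc,
      Polynomial.X_mul]
    abel
  rw [e, h1, h2, h3]
  simp

/-- The Schubert derivation `σ̄₊(z) : ⋀V → (⋀V)[z]`: the Hasse–Schmidt derivation (that is, the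
homomorphism of algebras) with `σ̄₊(z) v = v - σ_1(v) z` for `v ∈ V`. -/
def sigmaBarPlusPoly (A : Type*) [CommRing A] : LambdaV A →ₐ[A] Polynomial (LambdaV A) :=
  ExteriorAlgebra.lift A ⟨sigmaBarPlusGen A, sigmaBarPlusGen_sq A⟩

/-- The operators `σ̄_i` on `⋀V`, defined by `σ̄₊(z) = ∑_i (-1)^i σ̄_i z^i`. -/
def sigmaBar (A : Type*) [CommRing A] (i : ℕ) : Module.End A (LambdaV A) where
  toFun u := (-1 : A) ^ i • (sigmaBarPlusPoly A u).coeff i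
  map_add' u v := by simp
  map_smul' c u := by
    rw [map_smul, Polynomial.coeff_smul, smul_comm, RingHom.id_apply]

/-- `σ̄₊(c)` for an element `c` of the coefficient ring (see `sigmaBarPlus_eq_sum`). -/
def sigmaBarPlus (A : Type*) [CommRing A] (c : A) : LambdaV A →ₐ[A] LambdaV A :=
  ExteriorAlgebra.map (LinearMap.id - c • shiftUp A)

/-- The Schubert derivation `σ₋(c)` for a unit `c`: the homomorphism of algebras with
`σ₋(c) b_j = ∑_{i ≤ j} b_{j-i} c^{-i}`. -/
def sigmaMinus (A : Type*) [CommRing A] (c : Aˣ) : LambdaV A →ₐ[A] LambdaV A :=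
  ExteriorAlgebra.map (Finsupp.linearCombination A fun j =>
    ∑ i ∈ Finset.range (j + 1), ((c⁻¹ ^ i : Aˣ) : A) • b A (j - i))

theorem sigmaBarPlus_eq_sum (A : Type*) [CommRing A] (c : A) (u : LambdaV A) :
    sigmaBarPlus A c u
      = (sigmaBarPlusPoly A u).sum fun i _ => ((-1) ^ i * c ^ i) • sigmaBar A i u := by
  have hc : ∀ a : LambdaV A,
      Commute ((RingHom.id (LambdaV A)) a) (algebraMap A (LambdaV A) c) :=
    fun a => (Algebra.commutes c a).symm
  have key : (sigmaBarPlus A c : LambdaV A →+* LambdaV A)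
      = (Polynomial.eval₂RingHom' (RingHom.id (LambdaV A)) (algebraMap A (LambdaV A) c) hc).comp
          (sigmaBarPlusPoly A : LambdaV A →+* Polynomial (LambdaV A)) := by
    ext u
    simp only [RingHom.coe_coe, RingHom.comp_apply]
    induction u using ExteriorAlgebra.induction with
    | algebraMap r =>
      simp [Polynomial.eval₂RingHom', Polynomial.algebraMap_apply]
    | ι x =>
      simp [sigmaBarPlus, sigmaBarPlusPoly, sigmaBarPlusGen, Polynomial.eval₂RingHom',
        Polynomial.eval₂_sub, Algebra.smul_def, Algebra.commutes]
    | mul a b ha hb => rw [map_mul, map_mul, map_mul, ha, hb]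
    | add a b ha hb => rw [map_add, map_add, map_add, ha, hb]
  have h := congrArg (fun f => f u) key
  simp only [RingHom.coe_coe, RingHom.comp_apply, Polynomial.eval₂RingHom', RingHom.coe_mk,
    MonoidHom.coe_mk, OneHom.coe_mk, Polynomial.eval₂_eq_sum] at h
  rw [h]
  refine Finset.sum_congr rfl fun i _ => ?_
  have hs : ((-1 : A) ^ i) * (-1) ^ i = 1 := by rw [← mul_pow]; simp
  simp only [sigmaBar, LinearMap.coe_mk, AddHom.coe_mk, smul_smul, RingHom.id_apply]
  rw [mul_right_comm, hs, one_mul]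
  rw [← map_pow, ← Algebra.commutes, Algebra.smul_def]

/-! ### The `B_s`-module structure of the exterior algebra -/

theorem sigmaBar_mul (A : Type*) [CommRing A] (n : ℕ) (u v : LambdaV A) :
    sigmaBar A n (u * v)
      = ∑ p ∈ Finset.HasAntidiagonal.antidiagonal n, sigmaBar A p.1 u * sigmaBar A p.2 v := by
  simp only [sigmaBar, LinearMap.coe_mk, AddHom.coe_mk, map_mul, Polynomial.coeff_mul,
    Finset.smul_sum]
  refine Finset.sum_congr rfl fun p hp => ?_
  rw [smul_mul_smul_comm, ← pow_add, Finset.HasAntidiagonal.mem_antidiagonal.1 hp]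

theorem sigmaBar_algebraMap (A : Type*) [CommRing A] (n : ℕ) (r : A) :
    sigmaBar A n (algebraMap A _ r) = if n = 0 then algebraMap A _ r else 0 := by
  by_cases hn : n = 0 <;>
    simp [sigmaBar, Polynomial.algebraMap_apply, Polynomial.coeff_C, hn]

theorem sigmaBar_ι (A : Type*) [CommRing A] (n : ℕ) (v : V A) :
    sigmaBar A n (ExteriorAlgebra.ι A v) = if n = 0 then ExteriorAlgebra.ι A v else
      if n = 1 then ExteriorAlgebra.ι A (shiftUp A v) else 0 := by
  rcases n with _ | _ | n <;>
    simp [sigmaBar, sigmaBarPlusPoly, sigmaBarPlusGen, Polynomial.coeff_C, Polynomial.coeff_X]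

theorem sigmaBar_zero (A : Type*) [CommRing A] (u : LambdaV A) : sigmaBar A 0 u = u := by
  induction u using ExteriorAlgebra.induction with
  | algebraMap r => simp [sigmaBar_algebraMap]
  | ι x => simp [sigmaBar_ι]
  | mul a c ha hc => simp [sigmaBar_mul, ha, hc]
  | add a c ha hc => rw [map_add, ha, hc]

theorem sigmaBar_comm (A : Type*) [CommRing A] (i j : ℕ) :
    sigmaBar A i * sigmaBar A j = sigmaBar A j * sigmaBar A i := by
  refine LinearMap.ext fun u => ?_
  simp only [Module.End.mul_apply]
  induction u using ExteriorAlgebra.induction generalizing i j with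
  | algebraMap r =>
    by_cases hi : i = 0 <;> by_cases hj : j = 0 <;> simp [sigmaBar_algebraMap, hi, hj]
  | ι x =>
    rcases i with _ | _ | i <;> rcases j with _ | _ | j <;> simp [sigmaBar_ι]
  | mul a c ha hc =>
    simp only [sigmaBar_mul, map_sum, sigmaBar_mul]
    rw [Finset.sum_comm]
    refine Finset.sum_congr rfl fun p _ => Finset.sum_congr rfl fun q _ => ?_
    rw [ha, hc]
  | add a c ha hc => simp only [map_add, ha, hc]

open scoped IsMulCommutative in
/-- The action of `B_s = A[e_1, …, e_s]` on `⋀V` given by `e_i u = σ̄_i u`; the variable `X i` of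
`MvPolynomial (Fin s) A` is `e_{i+1}`. -/
def act (A : Type*) [CommRing A] (s : ℕ) :
    MvPolynomial (Fin s) A →ₐ[A] Module.End A (LambdaV A) :=
  have : IsMulCommutative (Algebra.adjoin A (Set.range (sigmaBar A))) :=
    Algebra.isMulCommutative_adjoin A <| by
      rintro _ ⟨i, rfl⟩ _ ⟨j, rfl⟩
      exact sigmaBar_comm A i j
  (Algebra.adjoin A (Set.range (sigmaBar A))).val.comp
    (MvPolynomial.aeval fun i : Fin s =>
      (⟨sigmaBar A (i + 1), Algebra.subset_adjoin ⟨_, rfl⟩⟩ :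
        Algebra.adjoin A (Set.range (sigmaBar A))))

theorem act_X (A : Type*) [CommRing A] (s : ℕ) (i : Fin s) :
    act A s (MvPolynomial.X i) = sigmaBar A (i + 1) := by
  simp [act]

/-- The generic polynomial `E_s(z) = 1 - e_1 z + ⋯ + (-1)^s e_s z^s`, as a power series. -/
def genericE (A : Type*) [CommRing A] (s : ℕ) : PowerSeries (MvPolynomial (Fin s) A) :=
  1 + ∑ i : Fin s, (-1) ^ ((i : ℕ) + 1) * PowerSeries.C (MvPolynomial.X i)
    * PowerSeries.X ^ ((i : ℕ) + 1)

/-- The sequence `H_s = (h_j)_{j ∈ ℤ}`, where `∑_{j ∈ ℤ} h_j z^j = 1 / E_s(z)`. -/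
def hSeq (A : Type*) [CommRing A] (s : ℕ) (j : ℤ) : MvPolynomial (Fin s) A :=
  if 0 ≤ j then PowerSeries.coeff j.toNat (PowerSeries.invOfUnit (genericE A s) 1) else 0

/-- The Schur determinant `Δ_λ(g) = det (g_{λ_j - j + i})_{1 ≤ i, j ≤ r}` of a sequence `g`. -/
def schurDet {B : Type*} [CommRing B] {r : ℕ} (lam : Fin r → ℕ) (g : ℤ → B) : B :=
  (Matrix.of fun i j : Fin r => g ((lam j : ℤ) - (j : ℤ) + (i : ℤ))).det

/-- For a sequence `g` with `g_j = 0` for `j < 0`, the sequence `j ↦ ∑_{i ≥ 0} g_{j-i} c^{-i}`.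
For `g = H_s` this is `σ₋(c) H_s`, that is `σ₋(c) h_j = ∑_{i ≥ 0} h_{j-i} c^{-i}`, for all `s ≥ 0`.
For `s ≥ 1` it is the sequence induced by the operator `σ₋(c)` on `⋀^s V`
(see `sigmaMinusSeqs_hSeq`). -/
def sigmaMinusSeq {A B : Type*} [CommRing A] [CommRing B] [Algebra A B] (c : Aˣ) (g : ℤ → B)
    (j : ℤ) : B :=
  ∑ i ∈ Finset.range (j.toNat + 1), ((c⁻¹ ^ i : Aˣ) : A) • g (j - i)

/-- `σ₋(w_k) = σ₋(w_1) ⋯ σ₋(w_k)` applied to the members of a sequence. -/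
def sigmaMinusSeqs {A B : Type*} [CommRing A] [CommRing B] [Algebra A B] {k : ℕ} (w : Fin k → Aˣ)
    (g : ℤ → B) : ℤ → B :=
  (List.ofFn w).foldl (fun g c => sigmaMinusSeq c g) g

/-- `σ₋(w_k) = σ₋(w_1) ⋯ σ₋(w_k)` on the exterior algebra. -/
def sigmaMinuses (A : Type*) [CommRing A] {k : ℕ} (w : Fin k → Aˣ) : LambdaV A →ₐ[A] LambdaV A :=
  (List.ofFn fun i => sigmaMinus A (w i)).prod

/-- `σ̄₊(w_k) = σ̄₊(w_1) ⋯ σ̄₊(w_k)` on the exterior algebra. -/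
def sigmaBarPluses (A : Type*) [CommRing A] {k : ℕ} (w : Fin k → Aˣ) :
    LambdaV A →ₐ[A] LambdaV A :=
  (List.ofFn fun i => sigmaBarPlus A (w i : A)).prod

/-! ### The sequence `σ₋(w_k) H_s` as the action of `σ₋(w_k)` transported from `⋀^s V` -/

/-- `[b]^m_0 = b_{m-1} ∧ ⋯ ∧ b_0`. -/
theorem bWedge_zero_succ (A : Type*) [CommRing A] (m : ℕ) :
    bWedge A (m + 1) (fun _ => 0) = ExteriorAlgebra.ι A (b A m) * bWedge A m (fun _ => 0) := by
  simp [bWedge, ExteriorAlgebra.ιMulti_succ_apply, Matrix.vecTail, Function.comp_def]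

theorem ι_b_mul_bWedge_zero (A : Type*) [CommRing A] (m q : ℕ) (hq : q < m) :
    ExteriorAlgebra.ι A (b A q) * bWedge A m (fun _ => 0) = 0 := by
  induction m with
  | zero => omega
  | succ m ih =>
    rw [bWedge_zero_succ, ← mul_assoc]
    rcases Nat.lt_succ_iff_lt_or_eq.1 hq with h | rfl
    · rw [eq_neg_of_add_eq_zero_left (ExteriorAlgebra.ι_add_mul_swap (b A q) (b A m)), neg_mul,
        mul_assoc, ih h, mul_zero, neg_zero]
    · rw [ExteriorAlgebra.ι_sq_zero, zero_mul]

theorem shiftUp_b (A : Type*) [CommRing A] (j : ℕ) : shiftUp A (b A j) = b A (j + 1) := by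
  simp [shiftUp, b]

theorem ι_mul_sigmaBar_bWedge_zero (A : Type*) [CommRing A] (m n : ℕ) (hn : n ≠ 0) :
    ExteriorAlgebra.ι A (b A m) * sigmaBar A n (bWedge A m fun _ => 0) = 0 := by
  induction m generalizing n with
  | zero =>
    have : bWedge A 0 (fun _ => 0) = algebraMap A _ 1 := by simp [bWedge]
    rw [this, sigmaBar_algebraMap, if_neg hn, mul_zero]
  | succ m ih =>
    rw [bWedge_zero_succ, sigmaBar_mul, Finset.mul_sum]
    refine Finset.sum_eq_zero fun p hp => ?_
    have hp' := Finset.HasAntidiagonal.mem_antidiagonal.1 hp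
    rw [sigmaBar_ι]
    split_ifs with h0 h1
    · rw [ih p.2 (by omega), mul_zero]
    · rw [shiftUp_b, ← mul_assoc, ExteriorAlgebra.ι_sq_zero, zero_mul]
    · rw [zero_mul, mul_zero]

/-- `σ̄_i` vanishes on `⋀^r V` for `i > r`. -/
theorem sigmaBar_bWedge_eq_zero (A : Type*) [CommRing A] (r : ℕ) (v : Fin r → V A) (i : ℕ)
    (hi : r < i) : sigmaBar A i (ExteriorAlgebra.ιMulti A r v) = 0 := by
  induction r generalizing i with
  | zero =>
    have : ExteriorAlgebra.ιMulti A 0 v = algebraMap A _ 1 := by simp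
    rw [this, sigmaBar_algebraMap, if_neg (by omega)]
  | succ r ih =>
    rw [ExteriorAlgebra.ιMulti_succ_apply, sigmaBar_mul]
    refine Finset.sum_eq_zero fun p hp => ?_
    have hp' := Finset.HasAntidiagonal.mem_antidiagonal.1 hp
    by_cases h : r < p.2
    · rw [ih _ _ h, mul_zero]
    · rw [sigmaBar_ι, if_neg (by omega), if_neg (by omega), zero_mul]

theorem coeff_genericE (A : Type*) [CommRing A] (s n : ℕ) :
    PowerSeries.coeff n (genericE A s) = if n = 0 then 1 else
      if h : n - 1 < s then (-1) ^ n * MvPolynomial.X ⟨n - 1, h⟩ else 0 := by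
  have hmon : ∀ i : Fin s, ((-1) ^ ((i : ℕ) + 1) * PowerSeries.C (MvPolynomial.X i)
      * PowerSeries.X ^ ((i : ℕ) + 1) : PowerSeries (MvPolynomial (Fin s) A))
      = PowerSeries.C ((-1) ^ ((i : ℕ) + 1) * MvPolynomial.X i)
        * PowerSeries.X ^ ((i : ℕ) + 1) := fun i => by simp
  simp only [genericE, map_add, map_sum, hmon, PowerSeries.coeff_C_mul, PowerSeries.coeff_X_pow,
    PowerSeries.coeff_one]
  rcases n with _ | n
  · simp
  · simp only [Nat.add_right_cancel_iff, Nat.add_sub_cancel, Nat.add_eq_zero_iff, one_ne_zero,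
      and_false, if_false, zero_add]
    split_ifs with h
    · rw [Finset.sum_eq_single ⟨n, h⟩]
      · simp
      · intro j _ hj
        rw [if_neg, mul_zero]
        rintro rfl
        exact hj rfl
      · simp
    · refine Finset.sum_eq_zero fun j _ => ?_
      rw [if_neg, mul_zero]
      rintro rfl
      exact h j.2

/-- `h_n [b]^s_0 = b_{s-1+n} ∧ b_{s-2} ∧ ⋯ ∧ b_0` for `s ≥ 1`. -/
theorem act_hSeq (A : Type*) [CommRing A] (m n : ℕ) :
    act A (m + 1) (hSeq A (m + 1) n) (bWedge A (m + 1) fun _ => 0)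
      = ExteriorAlgebra.ι A (b A (m + n)) * bWedge A m fun _ => 0 := by
  set c := bWedge A m fun _ => 0 with hc
  have hdeg : ∀ p i : ℕ, m + 1 < i → sigmaBar A i (ExteriorAlgebra.ι A (b A p) * c) = 0 := by
    intro p i hi
    rw [sigmaBar_mul]
    refine Finset.sum_eq_zero fun q hq => ?_
    have hq' := Finset.HasAntidiagonal.mem_antidiagonal.1 hq
    by_cases h : m < q.2
    · rw [hc, bWedge, sigmaBar_bWedge_eq_zero A m _ _ h, mul_zero]
    · rw [sigmaBar_ι, if_neg (by omega), if_neg (by omega), zero_mul]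
  have hE : ∀ p i : ℕ, act A (m + 1) (PowerSeries.coeff i (genericE A (m + 1)))
      (ExteriorAlgebra.ι A (b A p) * c)
      = (-1 : A) ^ i • sigmaBar A i (ExteriorAlgebra.ι A (b A p) * c) := by
    intro p i
    rw [coeff_genericE]
    split_ifs with h0 h1
    · subst h0
      simp [sigmaBar_zero]
    · have h2 : ((-1) ^ i * MvPolynomial.X ⟨i - 1, h1⟩ : MvPolynomial (Fin (m + 1)) A)
          = (-1 : A) ^ i • MvPolynomial.X ⟨i - 1, h1⟩ := by
        simp [MvPolynomial.smul_eq_C_mul]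
      rw [h2, map_smul, act_X, LinearMap.smul_apply]
      congr 3
      simp only
      omega
    · rw [hdeg p i (by omega)]; simp
  have hT : ∀ n : ℕ, ∑ p ∈ Finset.HasAntidiagonal.antidiagonal (n + 1), (-1 : A) ^ p.1 •
      sigmaBar A p.1 (ExteriorAlgebra.ι A (b A (m + p.2)) * c) = 0 := by
    intro n
    rw [Finset.Nat.sum_antidiagonal_eq_sum_range_succ_mk, Finset.sum_range_succ']
    set F : ℕ → LambdaV A := fun i =>
      (-1 : A) ^ i • (ExteriorAlgebra.ι A (b A (m + (n + 1 - i))) * sigmaBar A i c) with hF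
    have hstep : ∀ i ∈ Finset.range (n + 1), (-1 : A) ^ (i + 1) •
        sigmaBar A (i + 1) (ExteriorAlgebra.ι A (b A (m + (n + 1 - (i + 1)))) * c)
          = F (i + 1) - F i := by
      intro i hi
      have hi' := Finset.mem_range.1 hi
      rw [sigmaBar_mul, Finset.Nat.sum_antidiagonal_eq_sum_range_succ_mk,
        Finset.sum_range_succ', Finset.sum_range_succ', Finset.sum_eq_zero]
      · have e : m + (n + 1 - (i + 1)) + 1 = m + (n + 1 - i) := by omega
        simp only [sigmaBar_ι, shiftUp_b, hF, zero_add, if_true, one_ne_zero, if_false,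
          Nat.add_sub_cancel, Nat.sub_zero, e, smul_add, pow_succ, mul_neg, mul_one, neg_smul]
        abel
      · intro j _
        rw [sigmaBar_ι, if_neg (by omega), if_neg (by omega), zero_mul]
    rw [Finset.sum_congr rfl hstep, Finset.sum_range_sub]
    simp only [hF, pow_zero, one_smul, sigmaBar_zero, Nat.sub_self, add_zero, Nat.sub_zero]
    rw [hc, ι_mul_sigmaBar_bWedge_zero A m _ (Nat.succ_ne_zero n)]
    simp
  have hh : ∀ n : ℕ, hSeq A (m + 1) n
      = PowerSeries.coeff n (PowerSeries.invOfUnit (genericE A (m + 1)) 1) := by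
    intro n
    simp [hSeq]
  have hmul : genericE A (m + 1) * PowerSeries.invOfUnit (genericE A (m + 1)) 1 = 1 := by
    apply PowerSeries.mul_invOfUnit
    rw [← PowerSeries.coeff_zero_eq_constantCoeff_apply, coeff_genericE]
    simp
  induction n using Nat.strong_induction_on with
  | _ n ih =>
    have hco := congrArg (fun f => act A (m + 1) (PowerSeries.coeff n f)
      (bWedge A (m + 1) fun _ => 0)) hmul
    simp only [PowerSeries.coeff_mul, map_sum, map_mul, ← hh, LinearMap.sum_apply,
      Module.End.mul_apply] at hco
    rcases n with _ | n
    · simpa [coeff_genericE, bWedge_zero_succ, hc] using hco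
    · have h1 := hT n
      rw [Finset.Nat.sum_antidiagonal_succ] at h1 hco
      rw [PowerSeries.coeff_one, if_neg (Nat.succ_ne_zero n), map_zero, LinearMap.zero_apply,
        ← h1] at hco
      have htail : ∀ p ∈ Finset.HasAntidiagonal.antidiagonal n,
          act A (m + 1) (PowerSeries.coeff (p.1 + 1) (genericE A (m + 1)))
            (act A (m + 1) (hSeq A (m + 1) p.2) (bWedge A (m + 1) fun _ => 0))
          = (-1 : A) ^ (p.1 + 1) •
            sigmaBar A (p.1 + 1) (ExteriorAlgebra.ι A (b A (m + p.2)) * c) := by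
        intro p hp
        have hp' := Finset.HasAntidiagonal.mem_antidiagonal.1 hp
        rw [ih p.2 (by omega), hE]
      rw [Finset.sum_congr rfl htail, add_left_inj] at hco
      simpa [coeff_genericE, sigmaBar_zero] using hco

theorem hSeq_of_neg (A : Type*) [CommRing A] (s : ℕ) (j : ℤ) (hj : j < 0) : hSeq A s j = 0 := by
  simp [hSeq, hj]

/-- `σ₋(c)` acts as the identity on `[b]^m_0`. -/
theorem sigmaMinus_bWedge_zero (A : Type*) [CommRing A] (c : Aˣ) (m : ℕ) :
    sigmaMinus A c (bWedge A m fun _ => 0) = bWedge A m fun _ => 0 := by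
  induction m with
  | zero => simp [bWedge]
  | succ m ih =>
    rw [bWedge_zero_succ, map_mul, ih, sigmaMinus, ExteriorAlgebra.map_apply_ι, b,
      Finsupp.linearCombination_single, one_smul, map_sum, Finset.sum_mul,
      Finset.sum_range_succ', Finset.sum_eq_zero]
    · simp [b]
    · intro i hi
      have hi' := Finset.mem_range.1 hi
      rw [map_smul, smul_mul_assoc, ι_b_mul_bWedge_zero A m _ (by omega), smul_zero]

/-- For `s ≥ 1` the sequence `σ₋(c) H_s` is the one induced by `σ₋(c)` on `⋀^s V`. -/
theorem sigmaMinusSeq_hSeq (A : Type*) [CommRing A] (c : Aˣ) (s : ℕ) (hs : 1 ≤ s) (j : ℤ) :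
    act A s (sigmaMinusSeq c (hSeq A s) j) (bWedge A s fun _ => 0)
      = sigmaMinus A c (act A s (hSeq A s j) (bWedge A s fun _ => 0)) := by
  obtain ⟨m, rfl⟩ : ∃ m, s = m + 1 := ⟨s - 1, by omega⟩
  rcases lt_or_ge j 0 with hj | hj
  · have : j.toNat = 0 := by omega
    simp [sigmaMinusSeq, this, hSeq_of_neg A _ j hj]
  · lift j to ℕ using hj with n
    rw [act_hSeq, map_mul, sigmaMinus_bWedge_zero, sigmaMinus, ExteriorAlgebra.map_apply_ι, b,
      Finsupp.linearCombination_single, one_smul, map_sum, Finset.sum_mul, sigmaMinusSeq, map_sum,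
      LinearMap.sum_apply, Int.toNat_natCast]
    have hle : n + 1 ≤ m + n + 1 := by omega
    rw [← Finset.sum_subset (Finset.range_subset_range.2 hle)]
    · refine Finset.sum_congr rfl fun i hi => ?_
      have hi' := Finset.mem_range.1 hi
      have e : (n : ℤ) - i = ((n - i : ℕ) : ℤ) := by omega
      rw [map_smul, LinearMap.smul_apply, e, act_hSeq, map_smul, smul_mul_assoc]
      congr 5
      omega
    · intro i hi hi2
      have hi' := Finset.mem_range.1 hi
      have hi2' : ¬ i < n + 1 := fun h => hi2 (Finset.mem_range.2 h)
      rw [map_smul, smul_mul_assoc, ι_b_mul_bWedge_zero A m _ (by omega), smul_zero]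

/-- For `s ≥ 1` the sequence `σ₋(w_k) H_s` is the one induced by `σ₋(w_k)` on `⋀^s V`:
`(σ₋(w_k) h_j) [b]^s_0 = σ₋(w_k) (h_j [b]^s_0)`. -/
theorem sigmaMinusSeqs_hSeq (A : Type*) [CommRing A] {k : ℕ} (w : Fin k → Aˣ) (s : ℕ)
    (hs : 1 ≤ s) (j : ℤ) :
    act A s (sigmaMinusSeqs w (hSeq A s) j) (bWedge A s fun _ => 0)
      = sigmaMinuses A w (act A s (hSeq A s j) (bWedge A s fun _ => 0)) := by
  have key : ∀ (l : List Aˣ) (j : ℤ),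
      act A s (l.foldl (fun g c => sigmaMinusSeq c g) (hSeq A s) j) (bWedge A s fun _ => 0)
        = (l.map fun c => sigmaMinus A c).prod
            (act A s (hSeq A s j) (bWedge A s fun _ => 0)) := by
    intro l
    induction l using List.reverseRecOn with
    | nil => intro j; simp
    | append_singleton l c ih =>
      intro j
      rw [List.foldl_append, List.foldl_cons, List.foldl_nil, sigmaMinusSeq, map_sum,
        LinearMap.sum_apply]
      simp only [map_smul, LinearMap.smul_apply, ih]
      rw [List.map_append, List.prod_append, AlgHom.mul_apply]
      simp only [List.map_cons, List.map_nil, List.prod_cons, List.prod_nil, mul_one]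
      rw [← sigmaMinusSeq_hSeq A c s hs, sigmaMinusSeq, map_sum, LinearMap.sum_apply, map_sum]
      simp only [map_smul, LinearMap.smul_apply]
  rw [sigmaMinusSeqs, key, sigmaMinuses, List.map_ofFn]
  rfl

/-! ### The vertex operator `Γ*` -/

/-- The `A`-linear map `V → B^r` sending `b_n` to `(g_{n-(r-1)}, g_{n-(r-1)+1}, …, g_n)`. -/
def schurRow {A B : Type*} [CommRing A] [CommRing B] [Algebra A B] (r : ℕ) (g : ℤ → B) :
    V A →ₗ[A] (Fin r → B) :=
  Finsupp.linearCombination A fun n (i : Fin r) => g ((n : ℤ) - ((r : ℤ) - 1) + i)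

/-- The alternating map in `r` vectors of `V` that takes the value `Δ_λ(g)` on
`(b_{r-1+λ_1}, …, b_{λ_r})` (see `schurAlt_b`). -/
def schurAlt {A B : Type*} [CommRing A] [CommRing B] [Algebra A B] (r : ℕ) (g : ℤ → B) :
    V A [⋀^Fin r]→ₗ[A] B :=
  { ((Matrix.detRowAlternating (n := Fin r) (R := B)).toMultilinearMap.restrictScalars
      A).compLinearMap fun _ => schurRow r g with
    map_eq_zero_of_eq' := fun v i j hv hij =>
      (Matrix.detRowAlternating (n := Fin r) (R := B)).map_eq_zero_of_eq
        (fun l => schurRow r g (v l)) (by simp only [hv]) hij }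

theorem schurAlt_b {A B : Type*} [CommRing A] [CommRing B] [Algebra A B] (r : ℕ) (g : ℤ → B)
    (lam : Fin r → ℕ) :
    schurAlt (A := A) r g (fun i => b A ((i.rev : ℕ) + lam i)) = schurDet lam g := by
  have : schurAlt (A := A) r g (fun i => b A ((i.rev : ℕ) + lam i))
      = Matrix.det fun j => schurRow (A := A) r g (b A ((j.rev : ℕ) + lam j)) := rfl
  rw [this, schurDet, ← Matrix.det_transpose]
  congr 1
  ext i j
  simp only [Matrix.transpose_apply, schurRow, b, Finsupp.linearCombination_single, one_smul,
    Matrix.of_apply, Fin.val_rev]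
  congr 1
  have := j.2
  omega

/-- The vertex operator `Γ*(w_k)` on `⋀V`: the `A`-linear map with
`Γ*(w_k) [b]^r_λ = (σ̄₊(w_k) Δ_λ(σ₋(w_k) H_{r-k})) [b]^{r-k}_0`, where `⋀^{r-k} V = 0` for `k > r`
(see `gammaStar_bWedge`). -/
def gammaStar (A : Type*) [CommRing A] {k : ℕ} (w : Fin k → Aˣ) : LambdaV A →ₗ[A] LambdaV A :=
  ExteriorAlgebra.liftAlternating fun r =>
    if k ≤ r then
      ((sigmaBarPluses A w).toLinearMap ∘ₗ
          LinearMap.applyₗ (bWedge A (r - k) fun _ => 0) ∘ₗ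
          (act A (r - k)).toLinearMap).compAlternatingMap
        (schurAlt r (sigmaMinusSeqs w (hSeq A (r - k))))
    else 0

theorem gammaStar_bWedge (A : Type*) [CommRing A] {k : ℕ} (w : Fin k → Aˣ) (r : ℕ)
    (lam : Fin r → ℕ) :
    gammaStar A w (bWedge A r lam)
      = if k ≤ r then
          sigmaBarPluses A w
            (act A (r - k) (schurDet lam (sigmaMinusSeqs w (hSeq A (r - k))))
              (bWedge A (r - k) fun _ => 0))
        else 0 := by
  rw [gammaStar, bWedge, ExteriorAlgebra.liftAlternating_apply_ιMulti]
  split_ifs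
  · rw [← schurAlt_b (A := A)]
    rfl
  · rfl

/-! ### Contraction -/

/-- The generating series `β(c⁻¹) = ∑_{j ≥ 0} β_j c^{-j}` of the dual basis vectors
(`β_j(b_i) = δ_{ij}`), as a linear form on `V`; on each vector the sum is finite. -/
def beta (A : Type*) [CommRing A] (c : Aˣ) : Module.Dual A (V A) :=
  Finsupp.linearCombination A fun j => ((c⁻¹ ^ j : Aˣ) : A)

/-- The wedge product `β(w_k⁻¹) ∧ ⋯ ∧ β(w_1⁻¹)`. -/
def betaWedge (A : Type*) [CommRing A] {k : ℕ} (w : Fin k → Aˣ) :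
    ExteriorAlgebra A (Module.Dual A (V A)) :=
  ExteriorAlgebra.ιMulti A k fun i => beta A (w i.rev)

/-- Contraction `ω ↦ (ω ⌟ ·)` of multivectors against exterior forms.  For a linear form `ω` it is
the antiderivation of `⋀V` with `ω ⌟ v = ω(v)` on vectors, and `(α ∧ ω) ⌟ u = α ⌟ (ω ⌟ u)`. -/
def contract (A : Type*) [CommRing A] :
    ExteriorAlgebra A (Module.Dual A (V A)) →ₐ[A] Module.End A (LambdaV A) :=
  ExteriorAlgebra.lift A ⟨CliffordAlgebra.contractLeft, fun d =>
    LinearMap.ext fun u => CliffordAlgebra.contractLeft_contractLeft d u⟩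

/-! ### Formal variables -/

/-- The ring `ℚ[w_1^±¹, …, w_k^±¹]` of Laurent polynomials. -/
abbrev Laurent (k : ℕ) : Type := AddMonoidAlgebra ℚ (Fin k → ℤ)

/-- The formal variable `w_{i+1}`, a unit of the Laurent polynomial ring. -/
def wVar (k : ℕ) (i : Fin k) : (Laurent k)ˣ where
  val := AddMonoidAlgebra.single (Pi.single i 1) 1
  inv := AddMonoidAlgebra.single (Pi.single i (-1)) 1
  val_inv := by
    rw [AddMonoidAlgebra.single_mul_single, ← Pi.single_add, AddMonoidAlgebra.one_def]; simp
  inv_val := by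
    rw [AddMonoidAlgebra.single_mul_single, ← Pi.single_add, AddMonoidAlgebra.one_def]; simp

/-- The Vandermonde determinant `Δ_0(w_k) = ∏_{i < j} (w_j - w_i)`. -/
def vandermonde (k : ℕ) : Laurent k :=
  ∏ i : Fin k, ∏ j ∈ Finset.Ioi i, ((wVar k j : Laurent k) - (wVar k i : Laurent k))

end SchubertVertex

end

noncomputable section

namespace SchubertVertex

/-! ### Contraction of a decomposable multivector by a linear form -/

/-! Everything is encoded in generating series. If $\sum_j g_jz^j=1/P(z)$, then $\sigma_-(c)g$ has
series $1/\big(P(z)(1-c^{-1}z)\big)$; hence $\sigma_-(\mathbf w_k)H_s$ belongs to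
$E_s(z)\prod_i(1-w_i^{-1}z)$.

The core is `sum_beta_mul_schurAlt`: if $\deg P\le s$, contracting the alternating form $\Delta(g)$
of $s$ vectors with $\beta(c^{-1})$ gives $c^{-s}P(c)$ times the form $\Delta(\sigma_-(c)g)$ of
$s+1$ vectors. This is Cramer's rule, since $\beta(c^{-1})$ is a combination of the columns of the
larger matrix, with the coefficients of $P$ as weights.

The start of the iteration is the determinantal formula `act_schurAlt_hSeq`: $v_1\wedge\dots\wedge
v_s=\Delta(H_s)(v)\,[\mathbf b]^s_0$. With $s=r-k$, the $k$ contractions turn $\Delta(H_s)$ into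
$\Delta(\sigma_-(\mathbf w_k)H_s)$ and produce the factors $P(w_i)$. In these, $E_s(w_i)$ acts on
$B_s[\mathbf b]^s_0$ as $\overline\sigma_+(w_i)$ (`sigmaBarPlus_act_bWedge_zero`), while
$1-w_i/w_j=w_j^{-1}(w_j-w_i)$ supplies the Vandermonde product and powers of the $w_j$. If $k>r$,
both sides vanish by degree. -/

theorem contractLeft_ιMulti {A : Type*} [CommRing A] (d : Module.Dual A (V A)) (n : ℕ)
    (v : Fin (n + 1) → V A) :
    CliffordAlgebra.contractLeft d (ExteriorAlgebra.ιMulti A (n + 1) v : LambdaV A)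
      = ∑ j : Fin (n + 1), ((-1) ^ (j : ℕ) * d (v j)) •
          (ExteriorAlgebra.ιMulti A n (fun i => v (j.succAbove i)) : LambdaV A) := by
  induction n with
  | zero =>
    have h := CliffordAlgebra.contractLeft_ι_mul (Q := (0 : QuadraticForm A (V A))) (d := d) (v 0) 1
    simpa [ExteriorAlgebra.ιMulti_succ_apply] using h
  | succ n ih =>
    have h := CliffordAlgebra.contractLeft_ι_mul (Q := (0 : QuadraticForm A (V A))) (d := d) (v 0)
      (ExteriorAlgebra.ιMulti A (n + 1) (Matrix.vecTail v))
    rw [ExteriorAlgebra.ιMulti_succ_apply]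
    refine h.trans ?_
    rw [ih, Fin.sum_univ_succ (n := n + 1), Finset.mul_sum, sub_eq_add_neg,
      ← Finset.sum_neg_distrib]
    congr 1
    · simp [Matrix.vecTail, Function.comp_def]
    · refine Finset.sum_congr rfl fun j _ => ?_
      rw [ExteriorAlgebra.ιMulti_succ_apply (n := n) (fun i => v (j.succ.succAbove i)), mul_smul_comm,
        ← neg_smul]
      congr 1
      · simp [Matrix.vecTail, pow_succ]
      · simp [Matrix.vecTail, Function.comp_def]

/-! ### Sequences with a prescribed polynomial inverse generating series -/

section

variable {A B : Type*} [CommRing A] [CommRing B] [Algebra A B]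

/-- The sequence `g` vanishes in negative degrees and `∑_j g_j z^j = 1 / P(z)`. -/
structure IsInverseSeq (g : ℤ → B) (P : Polynomial B) : Prop where
  neg : ∀ j < 0, g j = 0
  mul_mk : (P : PowerSeries B) * PowerSeries.mk (fun n : ℕ => g n) = 1

theorem IsInverseSeq.unique {g g' : ℤ → B} {P : Polynomial B} (h : IsInverseSeq g P)
    (h' : IsInverseSeq g' P) : g = g' := by
  have e : PowerSeries.mk (fun n : ℕ => g n) = PowerSeries.mk (fun n : ℕ => g' n) := by
    calc _ = PowerSeries.mk (fun n : ℕ => g n)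
          * ((P : PowerSeries B) * PowerSeries.mk (fun n : ℕ => g' n)) := by
          rw [h'.mul_mk, mul_one]
      _ = (P : PowerSeries B) * PowerSeries.mk (fun n : ℕ => g n)
          * PowerSeries.mk (fun n : ℕ => g' n) := by ring
      _ = _ := by rw [h.mul_mk, one_mul]
  funext j
  rcases lt_or_ge j 0 with hj | hj
  · rw [h.neg j hj, h'.neg j hj]
  · lift j to ℕ using hj
    simpa using congrArg (PowerSeries.coeff j) e

theorem coeff_mul_mk (P : Polynomial B) (s : ℕ) (hP : P.natDegree ≤ s) (g : ℤ → B)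
    (hg : ∀ j < 0, g j = 0) (n : ℕ) :
    PowerSeries.coeff n ((P : PowerSeries B) * PowerSeries.mk (fun n : ℕ => g n))
      = ∑ p ∈ Finset.range (s + 1), P.coeff p * g ((n : ℤ) - p) := by
  rw [PowerSeries.coeff_mul, Finset.Nat.sum_antidiagonal_eq_sum_range_succ_mk]
  -- Both sums are extended to `max n s`: the terms added to one vanish because $\deg P\le s$, those
  -- added to the other because $g$ is zero in negative degrees.
  have e1 : ∀ t : ℕ, s ≤ t → ∑ p ∈ Finset.range (s + 1), P.coeff p * g ((n : ℤ) - p)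
      = ∑ p ∈ Finset.range (t + 1), P.coeff p * g ((n : ℤ) - p) := fun t ht =>
    Finset.sum_subset (Finset.range_subset_range.2 (by omega)) fun p _ hp => by
      rw [Polynomial.coeff_eq_zero_of_natDegree_lt, zero_mul]
      have : ¬ p < s + 1 := fun h => hp (Finset.mem_range.2 h)
      omega
  have e2 : ∑ p ∈ Finset.range (n + 1), P.coeff p * g ((n : ℤ) - p)
      = ∑ p ∈ Finset.range (max n s + 1), P.coeff p * g ((n : ℤ) - p) :=
    Finset.sum_subset (Finset.range_subset_range.2 (by omega)) fun p _ hp => by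
      have : ¬ p < n + 1 := fun h => hp (Finset.mem_range.2 h)
      rw [hg _ (by omega), mul_zero]
  rw [e1 (max n s) (by omega), ← e2]
  refine Finset.sum_congr rfl fun p hp => ?_
  have := Finset.mem_range.1 hp
  simp only [Polynomial.coeff_coe, PowerSeries.coeff_mk]
  congr 2
  omega

/-- At a negative index the defining sum is not empty: `j.toNat = 0` leaves the term `g j`, which
vanishes by `hg`. -/
theorem sigmaMinusSeq_of_neg (c : Aˣ) {g : ℤ → B} (hg : ∀ j < 0, g j = 0) {j : ℤ} (hj : j < 0) :
    sigmaMinusSeq c g j = 0 := by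
  have : j.toNat = 0 := by omega
  simp [sigmaMinusSeq, this, hg j hj]

theorem sigmaMinusSeq_eq_add (c : Aˣ) {g : ℤ → B} (hg : ∀ j < 0, g j = 0) (j : ℤ) :
    sigmaMinusSeq c g j = g j + ((c⁻¹ : Aˣ) : A) • sigmaMinusSeq c g (j - 1) := by
  rcases lt_or_ge j 0 with hj | hj
  · rw [sigmaMinusSeq_of_neg c hg hj, sigmaMinusSeq_of_neg c hg (by omega), hg j hj]; simp
  rcases hj.eq_or_lt with rfl | hj
  · rw [sigmaMinusSeq_of_neg c hg (j := 0 - 1) (by omega)]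
    simp [sigmaMinusSeq]
  · obtain ⟨n, rfl⟩ : ∃ n : ℕ, j = n + 1 := ⟨(j - 1).toNat, by omega⟩
    have e1 : ((n : ℤ) + 1).toNat = n + 1 := by omega
    have e2 : ((n : ℤ) + 1 - 1).toNat = n := by omega
    rw [sigmaMinusSeq, e1, Finset.sum_range_succ', sigmaMinusSeq, e2, Finset.smul_sum, add_comm]
    congr 1
    · simp
    · refine Finset.sum_congr rfl fun i _ => ?_
      rw [smul_smul, pow_succ', Units.val_mul]
      congr 2
      push_cast
      ring

/-- The polynomial `1 - c⁻¹ z`. -/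
def oneSubInv (B : Type*) [CommRing B] [Algebra A B] (c : Aˣ) : Polynomial B :=
  1 - Polynomial.C (algebraMap A B ((c⁻¹ : Aˣ) : A)) * Polynomial.X

theorem oneSubInv_mul_mk (c : Aˣ) {g : ℤ → B} (hg : ∀ j < 0, g j = 0) :
    (oneSubInv B c : PowerSeries B) * PowerSeries.mk (fun n : ℕ => sigmaMinusSeq c g n)
      = PowerSeries.mk (fun n : ℕ => g n) := by
  ext n
  rw [oneSubInv, Polynomial.coe_sub, Polynomial.coe_mul, Polynomial.coe_C, Polynomial.coe_X,
    Polynomial.coe_one, sub_mul, one_mul, map_sub, mul_assoc, PowerSeries.coeff_C_mul,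
    PowerSeries.coeff_mk, PowerSeries.coeff_mk, sigmaMinusSeq_eq_add c hg, Algebra.smul_def]
  rcases n with _ | n
  · rw [sigmaMinusSeq_of_neg c hg (by simp)]
    simp
  · rw [PowerSeries.coeff_succ_X_mul, PowerSeries.coeff_mk]
    simp

theorem IsInverseSeq.sigmaMinusSeq {g : ℤ → B} {P : Polynomial B} (h : IsInverseSeq g P) (c : Aˣ) :
    IsInverseSeq (sigmaMinusSeq c g) (P * oneSubInv B c) where
  neg _ hj := sigmaMinusSeq_of_neg c h.neg hj
  mul_mk := by rw [Polynomial.coe_mul, mul_assoc, oneSubInv_mul_mk c h.neg, h.mul_mk]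

theorem IsInverseSeq.sigmaMinusSeqs {g : ℤ → B} {P : Polynomial B} (h : IsInverseSeq g P) {k : ℕ}
    (w : Fin k → Aˣ) :
    IsInverseSeq (sigmaMinusSeqs w g) (P * ∏ i, oneSubInv B (w i)) := by
  induction k generalizing g P with
  | zero => simpa [SchubertVertex.sigmaMinusSeqs] using h
  | succ k ih =>
    have := ih (h.sigmaMinusSeq (w 0)) (fun i => w i.succ)
    rw [Fin.prod_univ_succ, ← mul_assoc]
    simpa [SchubertVertex.sigmaMinusSeqs, List.ofFn_succ] using this

/-- `P(z)` times the generating series of `σ₋(c) g` is `1 / (1 - c⁻¹ z)`. -/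
theorem IsInverseSeq.sum_coeff_mul_sigmaMinusSeq {g : ℤ → B} {P : Polynomial B}
    (h : IsInverseSeq g P) (c : Aˣ) (s : ℕ) (hP : P.natDegree ≤ s) (n : ℕ) :
    ∑ p ∈ Finset.range (s + 1), P.coeff p * SchubertVertex.sigmaMinusSeq c g ((n : ℤ) - p)
      = algebraMap A B ((c⁻¹ ^ n : Aˣ) : A) := by
  set G := SchubertVertex.sigmaMinusSeq c g
  have hG := (h.sigmaMinusSeq c).mul_mk
  rw [← coeff_mul_mk P s hP G (h.sigmaMinusSeq c).neg]
  set Q := (P : PowerSeries B) * PowerSeries.mk (fun n : ℕ => G n) with hQ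
  have hQ1 : (oneSubInv B c : PowerSeries B) * Q = 1 := by
    rw [← hG, Polynomial.coe_mul, hQ]; ring
  rw [oneSubInv, Polynomial.coe_sub, Polynomial.coe_mul, Polynomial.coe_C, Polynomial.coe_X,
    Polynomial.coe_one, sub_mul, one_mul, mul_assoc] at hQ1
  induction n with
  | zero => simpa using congrArg (PowerSeries.coeff 0) hQ1
  | succ n ih =>
    have := congrArg (PowerSeries.coeff (n + 1)) hQ1
    rw [map_sub, PowerSeries.coeff_C_mul, PowerSeries.coeff_succ_X_mul, ih, PowerSeries.coeff_one,
      if_neg (Nat.succ_ne_zero n), sub_eq_zero] at this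
    rw [this, ← map_mul, ← Units.val_mul, pow_succ']

/-! ### Contraction of a Schur determinant -/

theorem schurRow_single (r : ℕ) (g : ℤ → B) (n : ℕ) (i : Fin r) :
    schurRow (A := A) r g (Finsupp.single n 1) i = g ((n : ℤ) - ((r : ℤ) - 1) + i) := by
  simp [schurRow]

theorem schurAlt_apply (r : ℕ) (g : ℤ → B) (v : Fin r → V A) :
    schurAlt r g v = Matrix.det (Matrix.of fun l => schurRow r g (v l)) := rfl

/-- This is the recursion `sigmaMinusSeq_eq_add` read as a column operation. Rows of lengths $s+1$
and $s$ start at indices that differ by one, which absorbs the shift from `i` to `i.succ`. -/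
theorem schurRow_sigmaMinusSeq_succ (c : Aˣ) {g : ℤ → B} (hg : ∀ j < 0, g j = 0) (s : ℕ) (v : V A)
    (i : Fin s) :
    schurRow (s + 1) (sigmaMinusSeq c g) v i.succ
      = schurRow s g v i
        + algebraMap A B ((c⁻¹ : Aˣ) : A) * schurRow (s + 1) (sigmaMinusSeq c g) v i.castSucc := by
  have : LinearMap.proj i.succ ∘ₗ schurRow (A := A) (s + 1) (sigmaMinusSeq c g)
      = LinearMap.proj i ∘ₗ schurRow s g + ((c⁻¹ : Aˣ) : A) •
        (LinearMap.proj i.castSucc ∘ₗ schurRow (A := A) (s + 1) (sigmaMinusSeq c g)) := by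
    refine Finsupp.lhom_ext' fun n => LinearMap.ext_ring ?_
    simp only [LinearMap.comp_apply, LinearMap.add_apply, LinearMap.smul_apply,
      LinearMap.proj_apply, Finsupp.lsingle_apply, schurRow_single]
    rw [sigmaMinusSeq_eq_add c hg]
    congr 2
    · push_cast [Fin.val_succ]; ring
    · congr 1
      push_cast [Fin.val_succ, Fin.val_castSucc]; ring
  simpa [Algebra.smul_def] using LinearMap.congr_fun this v

/-- On $b_n$ both sides are the coefficient of $z^n$ in $P(z)\cdot 1/\big(P(z)(1-c^{-1}z)\big)$,
namely $c^{-n}$. The bound on the degree ensures that the $s+1$ entries of one row suffice. -/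
theorem algebraMap_beta {g : ℤ → B} {P : Polynomial B} (h : IsInverseSeq g P) (c : Aˣ) (s : ℕ)
    (hP : P.natDegree ≤ s) (v : V A) :
    algebraMap A B (beta A c v)
      = ∑ i : Fin (s + 1), P.coeff (s - i) * schurRow (s + 1) (sigmaMinusSeq c g) v i := by
  have : Algebra.linearMap A B ∘ₗ beta A c
      = ∑ i : Fin (s + 1), LinearMap.mulLeft A (P.coeff (s - i)) ∘ₗ LinearMap.proj i ∘ₗ
        schurRow (A := A) (s + 1) (sigmaMinusSeq c g) := by
    refine Finsupp.lhom_ext' fun n => LinearMap.ext_ring ?_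
    simp only [LinearMap.comp_apply, LinearMap.sum_apply, LinearMap.mulLeft_apply,
      LinearMap.proj_apply, Finsupp.lsingle_apply, schurRow_single, Algebra.linearMap_apply, beta,
      Finsupp.linearCombination_single, one_smul]
    rw [← h.sum_coeff_mul_sigmaMinusSeq c s hP n, ← Finset.sum_range_reflect,
      Finset.sum_range]
    refine Finset.sum_congr rfl fun i _ => ?_
    have := i.2
    have e : s + 1 - 1 - (i : ℕ) = s - i := by omega
    rw [e]
    congr 2
    push_cast [Nat.cast_sub (show (i : ℕ) ≤ s by omega)]
    ring
  simpa using LinearMap.congr_fun this v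

/-- Contraction of the alternating map `Δ(g)` of `s` vectors by `β(c⁻¹)` gives, up to a factor, the
alternating map `Δ(σ₋(c) g)` of `s + 1` vectors. -/
theorem sum_beta_mul_schurAlt {g : ℤ → B} {P : Polynomial B} (h : IsInverseSeq g P) (c : Aˣ)
    (s : ℕ) (hP : P.natDegree ≤ s) (v : Fin (s + 1) → V A) :
    ∑ j : Fin (s + 1), ((-1) ^ (j : ℕ) * beta A c (v j)) •
        schurAlt s g (fun i => v (j.succAbove i))
      = algebraMap A B ((c⁻¹ ^ s : Aˣ) : A) * P.eval (algebraMap A B (c : A))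
        * schurAlt (s + 1) (sigmaMinusSeq c g) v := by
  set M : Matrix (Fin (s + 1)) (Fin (s + 1)) B :=
    Matrix.of fun l => schurRow (s + 1) (sigmaMinusSeq c g) (v l) with hM
  -- `N` is `M` after subtracting from each column $c^{-1}$ times its predecessor: column 0 survives
  -- and the others form the matrix of $g$.
  set N : Matrix (Fin (s + 1)) (Fin (s + 1)) B :=
    Matrix.of fun l => Fin.cons (M l 0) (schurRow s g (v l)) with hN
  set u := algebraMap A B ((c⁻¹ : Aˣ) : A) with hu
  have hstep : ∀ l (i : Fin s), M l i.succ = N l i.succ + u * M l i.castSucc := fun l i => by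
    simpa [hM, hN] using schurRow_sigmaMinusSeq_succ c h.neg s (v l) i
  have hdet : M.det = N.det :=
    Matrix.det_eq_of_forall_col_eq_smul_add_pred (fun _ => u) (fun l => by simp [hN]) hstep
  -- Modulo columns $1,\dots,s$ of `N`, column $i$ of `M` is $c^{-i}$ times its column 0. Putting it
  -- in place of column 0 of `N` therefore multiplies the determinant by $c^{-i}$.
  have hcol : ∀ i : Fin (s + 1), N.cramer (fun l => M l i) 0 = u ^ (i : ℕ) * N.det := by
    intro i
    induction i using Fin.induction with
    | zero =>
      have : N.updateCol 0 (fun l => M l 0) = N := by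
        ext l i
        rcases eq_or_ne i 0 with rfl | hi
        · simp [hN]
        · simp [hi]
      rw [Matrix.cramer_apply, this]
      simp
    | succ i ih =>
      have : (fun l => M l i.succ) = (fun l => N l i.succ) + u • fun l => M l i.castSucc := by
        ext l; simp [hstep]
      rw [this, map_add, map_smul, Pi.add_apply, Pi.smul_apply, ih, Matrix.cramer_apply,
        Matrix.det_zero_of_column_eq (i := 0) (j := i.succ) (Fin.succ_ne_zero i).symm, zero_add,
        smul_eq_mul, Fin.val_succ, Fin.val_castSucc, pow_succ']
      · ring
      · intro l
        simp
  have hleft : ∑ j : Fin (s + 1), ((-1) ^ (j : ℕ) * beta A c (v j)) •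
        schurAlt s g (fun i => v (j.succAbove i))
      -- Laplace expansion along the new column 0; its minors are the values of $\Delta(g)$ with one
      -- vector omitted.
      = N.cramer (fun l => algebraMap A B (beta A c (v l))) 0 := by
    rw [Matrix.cramer_apply, Matrix.det_succ_column_zero]
    refine Finset.sum_congr rfl fun j _ => ?_
    rw [Algebra.smul_def, schurAlt_apply]
    congr 1
    · simp
  have hb : (fun l => algebraMap A B (beta A c (v l)))
      = ∑ i : Fin (s + 1), P.coeff (s - i) • fun l => M l i := by
    ext l
    rw [algebraMap_beta h c s hP]
    simp [hM]
  have hev : P.eval (algebraMap A B (c : A))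
      = ∑ i : Fin (s + 1), P.coeff (s - i) * algebraMap A B (c : A) ^ (s - i) := by
    rw [Polynomial.eval_eq_sum_range' (Nat.lt_succ_of_le hP), ← Finset.sum_range_reflect,
      Finset.sum_range]
    simp
  rw [hleft, hb, map_sum, Finset.sum_apply, schurAlt_apply, ← hM, hdet, hev, Finset.mul_sum,
    Finset.sum_mul]
  refine Finset.sum_congr rfl fun i _ => ?_
  rw [map_smul, Pi.smul_apply, hcol, smul_eq_mul]
  have hi : s = (s - i) + i := by have := i.2; omega
  have hc : algebraMap A B ((c⁻¹ ^ s : Aˣ) : A) * algebraMap A B (c : A) ^ (s - i) = u ^ (i : ℕ) := by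
    conv_lhs => enter [1]; rw [hi]
    rw [pow_add, Units.val_mul, map_mul, hu, ← map_pow, ← map_pow, ← Units.val_pow_eq_pow_val,
      ← Units.val_pow_eq_pow_val, mul_right_comm, ← map_mul, ← Units.val_mul, ← mul_pow]
    simp
  rw [← hc]
  ring

end

/-! ### The determinantal formula -/

theorem natDegree_trunc_genericE_le (A : Type*) [CommRing A] (s : ℕ) :
    (PowerSeries.trunc (s + 1) (genericE A s)).natDegree ≤ s :=
  Nat.lt_succ_iff.1 (PowerSeries.natDegree_trunc_lt _ s)

/-- $E_s$ is given as a power series but has degree at most $s$; its truncation is the same object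
as a polynomial, which can be evaluated at $w_i$. -/
theorem coe_trunc_genericE (A : Type*) [CommRing A] (s : ℕ) :
    (PowerSeries.trunc (s + 1) (genericE A s) : PowerSeries (MvPolynomial (Fin s) A))
      = genericE A s := by
  ext1 n
  rw [Polynomial.coeff_coe, PowerSeries.coeff_trunc]
  split_ifs with h
  · rfl
  · rw [coeff_genericE, if_neg (by omega), dif_neg (by omega)]

theorem isInverseSeq_hSeq (A : Type*) [CommRing A] (s : ℕ) :
    IsInverseSeq (hSeq A s) (PowerSeries.trunc (s + 1) (genericE A s)) where
  neg j hj := hSeq_of_neg A s j hj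
  mul_mk := by
    have : PowerSeries.mk (fun n : ℕ => hSeq A s n)
        = PowerSeries.invOfUnit (genericE A s) 1 := by
      ext1 n; simp [hSeq]
    rw [this, coe_trunc_genericE, PowerSeries.mul_invOfUnit]
    rw [← PowerSeries.coeff_zero_eq_constantCoeff_apply, coeff_genericE, if_pos rfl, Units.val_one]

theorem sum_coeff_genericE_mul_hSeq (A : Type*) [CommRing A] (s n : ℕ) (hn : n ≠ 0) :
    ∑ p ∈ Finset.range (s + 1), PowerSeries.coeff p (genericE A s) * hSeq A s ((n : ℤ) - p) = 0 := by
  have h := isInverseSeq_hSeq A s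
  have e := congrArg (PowerSeries.coeff n) h.mul_mk
  rw [coeff_mul_mk _ s (natDegree_trunc_genericE_le A s) _ h.neg, PowerSeries.coeff_one,
    if_neg hn] at e
  rw [← e]
  refine Finset.sum_congr rfl fun p hp => ?_
  rw [PowerSeries.coeff_trunc, if_pos (Finset.mem_range.1 hp)]

/-- The bound on `i` matters: beyond $s$ the coefficient is zero, whereas $\overline\sigma_i$ need
not vanish on all of $\bigwedge V$. -/
theorem act_coeff_genericE (A : Type*) [CommRing A] (s i : ℕ) (hi : i ≤ s) :
    act A s (PowerSeries.coeff i (genericE A s)) = (-1 : A) ^ i • sigmaBar A i := by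
  rw [coeff_genericE]
  split_ifs with h0 h1
  · subst h0
    rw [map_one, pow_zero, one_smul]
    exact LinearMap.ext fun u => (sigmaBar_zero A u).symm
  · obtain ⟨i, rfl⟩ := Nat.exists_eq_succ_of_ne_zero h0
    have e : ((-1 : MvPolynomial (Fin s) A) ^ (i + 1)) = algebraMap A _ ((-1) ^ (i + 1)) := by simp
    simp only [Nat.succ_eq_add_one, e, map_mul, AlgHom.commutes, act_X, Algebra.smul_def,
      Nat.add_sub_cancel]
  · omega

/-- Integration by parts in top degree: `∑_i (-1)^i σ̄_i (b_{n+m+1-i} ∧ u) = 0` for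
`u ∈ ⋀^m V`. -/
theorem sum_sigmaBar_ι_mul (A : Type*) [CommRing A] (m n : ℕ) (u : LambdaV A)
    (hu : sigmaBar A (m + 1) u = 0) :
    ∑ i ∈ Finset.range (m + 2), (-1 : A) ^ i •
      sigmaBar A i (ExteriorAlgebra.ι A (b A (n + m + 1 - i)) * u) = 0 := by
  -- Since $\overline\sigma_i(b_j\wedge
  -- u)=b_j\wedge\overline\sigma_iu+b_{j+1}\wedge\overline\sigma_{i-1}u$, the alternating sum
  -- telescopes to its last boundary term.
  have key : ∀ t ≤ n + m + 1, ∑ i ∈ Finset.range (t + 1), (-1 : A) ^ i •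
      sigmaBar A i (ExteriorAlgebra.ι A (b A (n + m + 1 - i)) * u)
      = (-1 : A) ^ t • (ExteriorAlgebra.ι A (b A (n + m + 1 - t)) * sigmaBar A t u) := by
    intro t ht
    induction t with
    | zero => simp [sigmaBar_zero]
    | succ t ih =>
      rw [Finset.sum_range_succ, ih (by omega), sigmaBar_mul,
        Finset.Nat.sum_antidiagonal_eq_sum_range_succ_mk, Finset.sum_range_succ',
        Finset.sum_range_succ', Finset.sum_eq_zero]
      · have e : n + m - t + 1 = n + m + 1 - t := by omega
        simp [sigmaBar_ι, shiftUp_b, e, pow_succ]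
      · intro i _
        simp [sigmaBar_ι]
  rw [key (m + 1) (by omega), hu, mul_zero, smul_zero]

/-- The alternating map `v ↦ Δ(H_s)(v) [b]^s_0`. -/
def schurActAlt (A : Type*) [CommRing A] (s : ℕ) : V A [⋀^Fin s]→ₗ[A] LambdaV A :=
  (LinearMap.applyₗ (bWedge A s fun _ => 0) ∘ₗ (act A s).toLinearMap).compAlternatingMap
    (schurAlt s (hSeq A s))

theorem schurActAlt_apply (A : Type*) [CommRing A] (s : ℕ) (v : Fin s → V A) :
    schurActAlt A s v = act A s (schurAlt s (hSeq A s) v) (bWedge A s fun _ => 0) := rfl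

/-- The determinant is linear in its first row, so the recursion $\sum_i(-1)^ie_ih_{N-i}=0$ for
$N>0$ applies entrywise. Starting at $b_{n+m+1}$ makes every $N=n+1+l$ positive. -/
theorem sum_act_schurActAlt (A : Type*) [CommRing A] (m n : ℕ) (v : Fin m → V A) :
    ∑ i ∈ Finset.range (m + 2), act A (m + 1) (PowerSeries.coeff i (genericE A (m + 1)))
      (schurActAlt A (m + 1) (Fin.cons (b A (n + m + 1 - i)) v)) = 0 := by
  set D := Matrix.detRowAlternating (n := Fin (m + 1)) (R := MvPolynomial (Fin (m + 1)) A)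
  set R : Fin m → Fin (m + 1) → MvPolynomial (Fin (m + 1)) A :=
    fun l => schurRow (m + 1) (hSeq A (m + 1)) (v l)
  have hD : ∀ x : V A, schurAlt (m + 1) (hSeq A (m + 1)) (Fin.cons x v : Fin (m + 1) → V A)
      = D.toMultilinearMap.toLinearMap (Fin.cons 0 R) 0 (schurRow (m + 1) (hSeq A (m + 1)) x) := by
    intro x
    rw [MultilinearMap.toLinearMap_apply, Fin.update_cons_zero]
    change D _ = D _
    congr 1
    funext l
    refine Fin.cases ?_ (fun l => ?_) l <;> rfl
  have hrow : ∑ i ∈ Finset.range (m + 2), PowerSeries.coeff i (genericE A (m + 1)) •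
      schurRow (A := A) (m + 1) (hSeq A (m + 1)) (b A (n + m + 1 - i)) = 0 := by
    funext l
    rw [Finset.sum_apply, Pi.zero_apply,
      ← sum_coeff_genericE_mul_hSeq A (m + 1) (n + 1 + l) (by omega)]
    refine Finset.sum_congr rfl fun i hi => ?_
    have := Finset.mem_range.1 hi
    rw [Pi.smul_apply, b, schurRow_single, smul_eq_mul]
    congr 2
    omega
  simp only [schurActAlt_apply, ← Module.End.mul_apply, ← map_mul]
  simp only [hD, ← smul_eq_mul, ← map_smul, ← LinearMap.sum_apply, ← map_sum]
  rw [hrow, map_zero, map_zero, LinearMap.zero_apply]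

theorem schurAlt_rev (A : Type*) [CommRing A] (s : ℕ) :
    schurAlt s (hSeq A s) (fun i : Fin s => b A (i.rev : ℕ)) = 1 := by
  have h0 : hSeq A s 0 = 1 := by simp [hSeq]
  rw [schurAlt_apply, Matrix.det_of_isUpperTriangular]
  · refine Finset.prod_eq_one fun i _ => ?_
    rw [Matrix.of_apply, b, schurRow_single, ← h0]
    congr 1
    have := i.2
    rw [Fin.val_rev]
    omega
  · intro i j hij
    have hij' : (j : ℕ) < i := hij
    rw [Matrix.of_apply, b, schurRow_single, hSeq_of_neg]
    have := i.2
    rw [Fin.val_rev]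
    omega

/-- The determinantal formula: `v_1 ∧ ⋯ ∧ v_s` is the Schur determinant of `H_s` acting on
`[b]^s_0`. -/
theorem act_schurAlt_hSeq (A : Type*) [CommRing A] (s : ℕ) (v : Fin s → V A) :
    act A s (schurAlt s (hSeq A s) v) (bWedge A s fun _ => 0) = ExteriorAlgebra.ιMulti A s v := by
  suffices h : schurActAlt A s = ExteriorAlgebra.ιMulti A s from congrArg (fun f => f v) h
  rw [← sub_eq_zero]
  set F := schurActAlt A s - ExteriorAlgebra.ιMulti A s with hF
  have hrev : F (fun i : Fin s => b A (i.rev : ℕ)) = 0 := by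
    rw [hF, AlternatingMap.sub_apply, schurActAlt_apply, schurAlt_rev]
    simp [bWedge]
  -- Both alternating maps satisfy the same recursion lowering one index $\ge s$, so their
  -- difference `F` vanishes by induction on the sum of the indices. Distinct indices below $s$ are
  -- a permutation of $s-1,\dots,0$, where `hrev` applies.
  have key : ∀ N (n : Fin s → ℕ), Function.Injective n → ∑ i, n i = N →
      F (fun i => b A (n i)) = 0 := by
    intro N
    induction N using Nat.strong_induction_on with
    | _ N ih =>
      intro n hn hN
      by_cases hlt : ∀ i, n i < s
      · let f : Fin s → Fin s := fun i => Fin.rev ⟨n i, hlt i⟩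
        have hf : Function.Injective f := fun i j hij => by
          have := Fin.rev_injective hij
          exact hn (by simpa using this)
        let σ : Equiv.Perm (Fin s) := Equiv.ofBijective f (Finite.injective_iff_bijective.1 hf)
        have e : (fun i => b A (n i)) = (fun i : Fin s => b A (i.rev : ℕ)) ∘ σ := by
          funext i
          simp only [σ, f, Function.comp_apply, Equiv.ofBijective_apply, Fin.rev_rev]
        rw [e, AlternatingMap.map_perm, hrev, smul_zero]
      · push Not at hlt
        obtain ⟨j, hj⟩ := hlt
        obtain ⟨m, rfl⟩ : ∃ m, s = m + 1 := ⟨s - 1, by have := j.2; omega⟩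
        have hswap := AlternatingMap.map_perm F (fun i => b A (n i)) (Equiv.swap 0 j)
        set n' : Fin (m + 1) → ℕ := n ∘ Equiv.swap 0 j with hn'
        have hn0 : m + 1 ≤ n' 0 := by simpa [hn'] using hj
        have hsum : ∑ i, n' i = N := by
          rw [← hN]; exact Equiv.sum_comp (Equiv.swap 0 j) n
        suffices h : F (fun i => b A (n' i)) = 0 by
          have h2 : (Equiv.Perm.sign (Equiv.swap 0 j)) • F (fun i => b A (n i)) = 0 :=
            hswap.symm.trans h
          exact (smul_eq_zero_iff_eq _).1 h2
        obtain ⟨q, hq⟩ : ∃ q, n' 0 = q + m + 1 := ⟨n' 0 - (m + 1), by omega⟩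
        set t : Fin m → V A := fun i => b A (n' i.succ) with ht
        have hrec : ∑ i ∈ Finset.range (m + 2),
            act A (m + 1) (PowerSeries.coeff i (genericE A (m + 1)))
              (F (Fin.cons (b A (q + m + 1 - i)) t : Fin (m + 1) → V A)) = 0 := by
          simp only [hF, AlternatingMap.sub_apply, map_sub, Finset.sum_sub_distrib]
          rw [sum_act_schurActAlt, zero_sub, neg_eq_zero,
            ← sum_sigmaBar_ι_mul A m q (ExteriorAlgebra.ιMulti A m t)
              (sigmaBar_bWedge_eq_zero A m t (m + 1) (Nat.lt_succ_self m))]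
          refine Finset.sum_congr rfl fun i hi => ?_
          have := Finset.mem_range.1 hi
          rw [act_coeff_genericE A (m + 1) i (by omega), LinearMap.smul_apply,
            ExteriorAlgebra.ιMulti_succ_apply]
          simp [Matrix.vecTail, Function.comp_def]
        -- Only the term $i=0$, with coefficient 1, is left: the others have a smaller index sum, or
        -- a repeated index and vanish by alternation.
        rw [Finset.sum_range_succ', Finset.sum_eq_zero, zero_add] at hrec
        · have e : (fun i => b A (n' i)) = (Fin.cons (b A (q + m + 1)) t : Fin (m + 1) → V A) := by
            funext i
            refine Fin.cases ?_ (fun i => ?_) i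
            · simp [hq]
            · simp [ht]
          rw [e]
          simpa [coeff_genericE] using hrec
        · intro i hi
          have := Finset.mem_range.1 hi
          have e : (Fin.cons (b A (q + m + 1 - (i + 1))) t : Fin (m + 1) → V A)
              = fun l => b A ((Fin.cons (q + m + 1 - (i + 1)) (fun l : Fin m => n' l.succ) :
                Fin (m + 1) → ℕ) l) := by
            funext l
            refine Fin.cases ?_ (fun l => ?_) l
            · simp
            · simp [ht]
          rw [e]
          by_cases hinj : Function.Injective (Fin.cons (q + m + 1 - (i + 1))
              (fun l : Fin m => n' l.succ) : Fin (m + 1) → ℕ)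
          · rw [ih _ ?_ _ hinj rfl, map_zero]
            rw [← hsum, Fin.sum_univ_succ, Fin.sum_univ_succ]
            simp only [Fin.cons_zero, Fin.cons_succ, hq]
            omega
          · rw [AlternatingMap.map_eq_zero_of_not_injective, map_zero]
            intro h
            exact hinj (Function.Injective.of_comp (f := b A) h)
  refine Module.Basis.ext_alternating (Finsupp.basisSingleOne (R := A)) fun n hn => ?_
  have := key _ n hn rfl
  simpa [b] using this

/-! ### The Schubert derivation `σ̄₊` on `B_s [b]^s_0` -/

theorem sigmaBar_act (A : Type*) [CommRing A] (s i : ℕ) (p : MvPolynomial (Fin s) A)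
    (u : LambdaV A) : sigmaBar A i (act A s p u) = act A s p (sigmaBar A i u) := by
  induction p using MvPolynomial.induction_on generalizing u with
  | C a =>
    rw [← MvPolynomial.algebraMap_eq, AlgHom.commutes]
    simp [Module.algebraMap_end_apply]
  | add p q hp hq => simp [hp, hq]
  | mul_X p j hp =>
    have h := LinearMap.congr_fun (sigmaBar_comm A i (j + 1)) u
    simp only [Module.End.mul_apply] at h
    simp only [map_mul, Module.End.mul_apply, act_X, hp, h]

/-- The operators $\overline\sigma_i$ commute with the action of $B_s$ and kill $[\mathbf b]^s_0$
for $i>s$. On $B_s[\mathbf b]^s_0$ the series $\overline\sigma_+(c)$ thus stops at $i=s$ and becomes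
multiplication by $E_s(c)$. -/
theorem sigmaBarPlus_act_bWedge_zero (A : Type*) [CommRing A] (c : A) (s : ℕ)
    (p : MvPolynomial (Fin s) A) :
    sigmaBarPlus A c (act A s p (bWedge A s fun _ => 0))
      = act A s ((PowerSeries.trunc (s + 1) (genericE A s)).eval (algebraMap A _ c) * p)
          (bWedge A s fun _ => 0) := by
  set u := act A s p (bWedge A s fun _ => 0) with hu
  have hz : ∀ i, s < i → sigmaBar A i u = 0 := fun i hi => by
    rw [hu, sigmaBar_act, bWedge, sigmaBar_bWedge_eq_zero A s _ i hi, map_zero]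
  set N := max (s + 1) ((sigmaBarPlusPoly A u).natDegree + 1)
  have h1 : sigmaBarPlus A c u
      = ∑ i ∈ Finset.range N, ((-1) ^ i * c ^ i) • sigmaBar A i u := by
    rw [sigmaBarPlus_eq_sum, Polynomial.sum_def]
    refine Finset.sum_subset (fun i hi => ?_) fun i _ hi => ?_
    · have := Polynomial.le_natDegree_of_mem_supp i hi
      exact Finset.mem_range.2 (by omega)
    · have : (sigmaBarPlusPoly A u).coeff i = 0 := Polynomial.notMem_support_iff.1 hi
      simp [sigmaBar, this]
  have h2 : ∑ i ∈ Finset.range (s + 1), ((-1) ^ i * c ^ i) • sigmaBar A i u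
      = ∑ i ∈ Finset.range N, ((-1) ^ i * c ^ i) • sigmaBar A i u :=
    Finset.sum_subset (Finset.range_subset_range.2 (le_max_left _ _)) fun i _ hi => by
      have : ¬ i < s + 1 := fun h => hi (Finset.mem_range.2 h)
      rw [hz i (by omega), smul_zero]
  rw [h1, ← h2, Polynomial.eval_eq_sum_range' (Nat.lt_succ_of_le
    (natDegree_trunc_genericE_le A s)), map_mul, Module.End.mul_apply, ← hu, map_sum,
    LinearMap.sum_apply]
  refine Finset.sum_congr rfl fun i hi => ?_
  have hi' := Finset.mem_range.1 hi
  rw [PowerSeries.coeff_trunc, if_pos hi', map_mul, act_coeff_genericE A s i (by omega), ← map_pow,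
    AlgHom.commutes, Module.End.mul_apply, Module.algebraMap_end_apply, map_smul,
    LinearMap.smul_apply, smul_smul, mul_comm]

theorem sigmaBarPluses_act_bWedge_zero (A : Type*) [CommRing A] {k : ℕ} (w : Fin k → Aˣ) (s : ℕ)
    (p : MvPolynomial (Fin s) A) :
    sigmaBarPluses A w (act A s p (bWedge A s fun _ => 0))
      = act A s ((∏ i, (PowerSeries.trunc (s + 1) (genericE A s)).eval
          (algebraMap A _ (w i : A))) * p) (bWedge A s fun _ => 0) := by
  induction k with
  | zero => simp [sigmaBarPluses]
  | succ k ih =>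
    have := ih (fun i => w i.succ)
    rw [sigmaBarPluses] at this ⊢
    rw [List.ofFn_succ, List.prod_cons, AlgHom.mul_apply, this, sigmaBarPlus_act_bWedge_zero,
      Fin.prod_univ_succ, mul_assoc]

/-! ### Iterated contraction -/

/-- The form $\beta(w_0^{-1})$ is the last factor of the wedge, hence the first to be contracted. -/
theorem contract_betaWedge_succ (A : Type*) [CommRing A] {k : ℕ} (w : Fin (k + 1) → Aˣ)
    (u : LambdaV A) :
    contract A (betaWedge A w) u
      = contract A (betaWedge A fun i => w i.succ)
          (CliffordAlgebra.contractLeft (beta A (w 0)) u) := by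
  have h : betaWedge A w
      = betaWedge A (fun i => w i.succ) * ExteriorAlgebra.ι A (beta A (w 0)) := by
    simp only [betaWedge, ExteriorAlgebra.ιMulti_apply]
    rw [List.ofFn_succ', List.prod_concat]
    simp [Fin.rev_castSucc]
  have h1 : contract A (ExteriorAlgebra.ι A (beta A (w 0)))
      = CliffordAlgebra.contractLeft (beta A (w 0)) := by
    rw [contract, ExteriorAlgebra.lift_ι_apply]
  rw [h, map_mul, Module.End.mul_apply, h1]

theorem contract_betaWedge_eq_zero (A : Type*) [CommRing A] {k : ℕ} (w : Fin k → Aˣ) (r : ℕ)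
    (hr : r < k) (v : Fin r → V A) :
    contract A (betaWedge A w) (ExteriorAlgebra.ιMulti A r v) = 0 := by
  induction k generalizing r with
  | zero => omega
  | succ k ih =>
    rw [contract_betaWedge_succ]
    rcases r with _ | r
    · have : CliffordAlgebra.contractLeft (Q := (0 : QuadraticForm A (V A))) (beta A (w 0)) 1 = 0 :=
        CliffordAlgebra.contractLeft_one _ _
      rw [ExteriorAlgebra.ιMulti_zero_apply, this, map_zero]
    · rw [contractLeft_ιMulti, map_sum]
      refine Finset.sum_eq_zero fun j _ => ?_
      rw [map_smul, ih _ r (by omega), smul_zero]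

theorem natDegree_prod_oneSubInv_le {A : Type*} (B : Type*) [CommRing A] [CommRing B] [Algebra A B]
    {k : ℕ} (w : Fin k → Aˣ) : (∏ i, oneSubInv B (w i)).natDegree ≤ k := by
  refine (Polynomial.natDegree_prod_le _ _).trans ?_
  refine (Finset.sum_le_card_nsmul _ _ 1 fun i _ => ?_).trans (by simp)
  simp only [oneSubInv]
  compute_degree

theorem eval_prod_oneSubInv {A : Type*} (B : Type*) [CommRing A] [CommRing B] [Algebra A B]
    {k : ℕ} (w : Fin k → Aˣ) (c : A) :
    (∏ i, oneSubInv B (w i)).eval (algebraMap A B c)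
      = algebraMap A B (((∏ i, w i)⁻¹ : Aˣ) * ∏ i, ((w i : A) - c)) := by
  rw [Polynomial.eval_prod, ← Finset.prod_inv_distrib, Units.coe_prod, ← Finset.prod_mul_distrib,
    map_prod]
  refine Finset.prod_congr rfl fun i _ => ?_
  simp [oneSubInv, mul_sub]

theorem contract_betaWedge_ιMulti (A : Type*) [CommRing A] {k : ℕ} (w : Fin k → Aˣ) (s : ℕ)
    (v : Fin (s + k) → V A) :
    contract A (betaWedge A w) (ExteriorAlgebra.ιMulti A (s + k) v)
      = ((∏ i : Fin k, ∏ j ∈ Finset.Ioi i, ((w j : A) - (w i : A))) *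
          (((∏ i, w i) ^ (((s + k : ℕ) : ℤ) - 1))⁻¹ : Aˣ)) •
        sigmaBarPluses A w (act A s (schurAlt (s + k) (sigmaMinusSeqs w (hSeq A s)) v)
          (bWedge A s fun _ => 0)) := by
  simp only [sigmaBarPluses_act_bWedge_zero]
  induction k with
  | zero =>
    have h : sigmaMinusSeqs w (hSeq A s) = hSeq A s := by simp [sigmaMinusSeqs]
    have h1 : betaWedge A w = 1 := by simp [betaWedge]
    rw [h, h1, map_one]
    simpa using (act_schurAlt_hSeq A s v).symm
  | succ k ih =>
    -- Packaging $p\mapsto p\,[\mathbf b]^s_0$ as a linear map lets the scalars and the sum over the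
    -- omitted vector pass inside to the Schur forms.
    obtain ⟨L, hL⟩ : ∃ L : MvPolynomial (Fin s) A →ₗ[A] LambdaV A,
        ∀ p, act A s p (bWedge A s fun _ => 0) = L p :=
      ⟨LinearMap.applyₗ (bWedge A s fun _ => 0) ∘ₗ (act A s).toLinearMap, fun _ => rfl⟩
    simp only [hL] at ih ⊢
    set w' : Fin k → Aˣ := fun i => w i.succ with hw'
    set B := MvPolynomial (Fin s) A
    set E : Polynomial B := PowerSeries.trunc (s + 1) (genericE A s)
    set g := sigmaMinusSeqs w' (hSeq A s) with hg
    have hgP : IsInverseSeq g (E * ∏ i, oneSubInv B (w' i)) :=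
      (isInverseSeq_hSeq A s).sigmaMinusSeqs w'
    have hdeg : (E * ∏ i, oneSubInv B (w' i)).natDegree ≤ s + k :=
      Polynomial.natDegree_mul_le_of_le (natDegree_trunc_genericE_le A s)
        (natDegree_prod_oneSubInv_le B w')
    -- The fold applies $\sigma_-(w_0)$ innermost, while the induction needs it outermost. Both
    -- sequences invert the same polynomial, so they coincide.
    have hseq : sigmaMinusSeqs w (hSeq A s) = sigmaMinusSeq (w 0) g := by
      refine ((isInverseSeq_hSeq A s).sigmaMinusSeqs w).unique ?_
      rw [Fin.prod_univ_succ, mul_comm (oneSubInv _ _), ← mul_assoc]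
      exact hgP.sigmaMinusSeq (w 0)
    have hsum := sum_beta_mul_schurAlt hgP (w 0) (s + k) hdeg v
    set T := ∏ i, w' i with hT
    -- The extra factors are $w_0^{-(s+k)}$, from the contraction, and $T^{-1}$, from
    -- $\prod_i(1-w_0/w'_i)=T^{-1}\prod_i(w'_i-w_0)$.
    have hunit : ((∏ i, w i) ^ (((s + (k + 1) : ℕ) : ℤ) - 1))⁻¹
        = (T ^ (((s + k : ℕ) : ℤ) - 1))⁻¹ * ((w 0)⁻¹ ^ (s + k) * T⁻¹) := by
      have e : (((s + (k + 1) : ℕ) : ℤ) - 1) = ((s + k : ℕ) : ℤ) := by push_cast; ring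
      rw [e, Fin.prod_univ_succ, ← hT, zpow_sub_one, zpow_natCast, zpow_natCast, mul_pow, mul_inv,
        mul_inv, inv_inv, inv_pow, mul_assoc (T ^ (s + k))⁻¹, mul_left_comm T, mul_inv_cancel,
        mul_one, mul_comm]
    have hvand : ∏ i : Fin (k + 1), ∏ j ∈ Finset.Ioi i, ((w j : A) - (w i : A))
        = (∏ i, ((w' i : A) - (w 0 : A))) *
          ∏ i : Fin k, ∏ j ∈ Finset.Ioi i, ((w' j : A) - (w' i : A)) := by
      rw [Fin.prod_univ_succ]
      congr 1
      · rw [Fin.prod_Ioi_zero]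
      · refine Finset.prod_congr rfl fun i _ => ?_
        rw [Fin.prod_Ioi_succ]
    rw [contract_betaWedge_succ]
    refine (congrArg _ (contractLeft_ιMulti (beta A (w 0)) (s + k) v)).trans ?_
    rw [map_sum]
    simp only [map_smul]
    rw [Finset.sum_congr rfl fun j _ => congrArg _ (ih w' fun i => v (j.succAbove i))]
    simp only [smul_comm _ ((∏ i : Fin k, ∏ j ∈ Finset.Ioi i, ((w' j : A) - (w' i : A))) * _)]
    rw [← Finset.smul_sum]
    simp only [← map_smul, ← mul_smul_comm]
    have hcast : ∀ G : ℤ → B, schurAlt (s + (k + 1)) G v = schurAlt (s + k + 1) G v := fun _ => rfl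
    rw [← map_sum, ← Finset.mul_sum, ← hg, hsum, hseq, hunit, hvand, Polynomial.eval_mul,
      eval_prod_oneSubInv, ← hT, Fin.prod_univ_succ, hcast, ← map_smul]
    congr 1
    simp only [Algebra.smul_def, Units.val_mul, map_mul]
    ring

end SchubertVertex

end

/-- For $k\le r$ this specialises `contract_betaWedge_ιMulti`, valid for any units of a commutative
ring and any vectors, to the Laurent variables and basis vectors. -/
theorem mainTheorem3 (k r : ℕ) (lam : Fin r → ℕ) (hlam : Antitone lam) :
    SchubertVertex.contract (SchubertVertex.Laurent k)
        (SchubertVertex.betaWedge (SchubertVertex.Laurent k) (SchubertVertex.wVar k))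
        (SchubertVertex.bWedge (SchubertVertex.Laurent k) r lam)
      = (SchubertVertex.vandermonde k *
          (((∏ i : Fin k, SchubertVertex.wVar k i) ^ ((r : ℤ) - 1))⁻¹ :
            (SchubertVertex.Laurent k)ˣ)) •
        SchubertVertex.gammaStar (SchubertVertex.Laurent k) (SchubertVertex.wVar k)
          (SchubertVertex.bWedge (SchubertVertex.Laurent k) r lam) := by
  rw [SchubertVertex.gammaStar_bWedge]
  split_ifs with h
  · obtain ⟨s, rfl⟩ := Nat.exists_eq_add_of_le' h
    rw [Nat.add_sub_cancel, ← SchubertVertex.schurAlt_b (A := SchubertVertex.Laurent k)]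
    exact SchubertVertex.contract_betaWedge_ιMulti _ _ s _
  · rw [smul_zero]
    exact SchubertVertex.contract_betaWedge_eq_zero _ _ r (by omega) _
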